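/- Let $\alpha\in(0,1)\cup(1,2)$, $L>0$, and $u:\mathbb R\to\mathbb C$. Put $u(s)\equiv u(L\cot s)$ for $s\in(0,\pi)$, assume that $u_s$ and $u_{ss}$ exist on $(0,\pi)$, and that $$f(s)=\sin(s)\,u_{ss}(s)+2\cos(s)\,u_s(s)$$ belongs to $C^2[0,\pi]$ (that is, $f$ extends from $(0,\pi)$ to a twice continuously differentiable function on $[0,\pi]$, with one-sided derivatives at the end points). Let $c_\alpha=\alpha\,\dfrac{2^{\alpha-1}\Gamma(1/2+\alpha/2)}{\sqrt\pi\,\Gamma(1-\alpha/2)}$, and define the fractional Laplacian of $u$ at $x=L\cot s$, in mapped form, by $$(-\Delta)^{\alpha/2}u(s)=\frac{c_\alpha|\sin s|^{\alpha-1}}{L^\alpha\alpha(1-\alpha)}\int_0^\pi\frac{\sin^\alpha(\eta)\,f(\eta)}{|\sin(s-\eta)|^{\alpha-1}}\,d\eta .$$ For integers $N,r\ge1$ let $h_r=\dfrac{\pi}{2rN}$, $\tilde s_t=h_r t$ (for integers and half-integers $t$), and $s_j=\dfrac{(2j+1)\pi}{2N}$ for $j\in\{0,\dots,N-1\}$.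 Write $$w_{n,j}=\frac{\operatorname{sgn}(\tilde s_{n+1}-s_j)|\tilde s_{n+1}-s_j|^{2-\alpha}-\operatorname{sgn}(\tilde s_n-s_j)|\tilde s_n-s_j|^{2-\alpha}}{2-\alpha},\qquad C_j=\frac{1}{h_r}\,\frac{c_\alpha|\sin s_j|^{\alpha-1}}{L^\alpha\alpha(1-\alpha)},$$ and define $$A_{1,j}=C_j\sum_{n=0}^{rN-1}\left(\frac{\sin\tilde s_{n+1/2}}{\tilde s_{n+1/2}}\right)^{\alpha}\left(\frac{\sin(\tilde s_{n+1/2}-s_j)}{\tilde s_{n+1/2}-s_j}\right)^{1-\alpha}\frac{\tilde s_{n+1}^{\alpha+1}-\tilde s_n^{\alpha+1}}{\alpha+1}\,w_{n,j}\,f(\tilde s_{n+1/2}),$$ $$A_{2,j}=C_j\sum_{n=rN}^{2rN-1}\left(\frac{\sin\tilde s_{n+1/2}}{\pi-\tilde s_{n+1/2}}\right)^{\alpha}\left(\frac{\sin(\tilde s_{n+1/2}-s_j)}{\tilde s_{n+1/2}-s_j}\right)^{1-\alpha}\frac{(\pi-\tilde s_n)^{\alpha+1}-(\pi-\tilde s_{n+1})^{\alpha+1}}{\alpha+1}\,w_{n,j}\,f(\tilde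 s_{n+1/2}).$$ Then, for every $N\ge1$, the integrals defining $(-\Delta)^{\alpha/2}u(s_j)$, $0\le j\le N-1$, converge absolutely, and there is a constant $K>0$, independent of $r$ and $j$, such that for all $r\ge1$ and all $j\in\{0,\dots,N-1\}$ $$\left|(-\Delta)^{\alpha/2}u(s_j)-A_{1,j}-A_{2,j}\right|\le\frac{K}{r^2}.$$ -/

import Mathlib

namespace FracLap

/-- The constant `c_α = α 2^(α-1) Γ(1/2 + α/2) / (√π Γ(1 - α/2))` of the fractional Laplacian. -/
noncomputable def cConst (α : ℝ) : ℝ :=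
  α * ((2 : ℝ) ^ (α - 1) * Real.Gamma (1 / 2 + α / 2)) /
    (Real.sqrt Real.pi * Real.Gamma (1 - α / 2))

/-- The function `u` in the mapped variable: `s ↦ u (L cot s)`, for `s ∈ (0, π)`. -/
noncomputable def mapped (L : ℝ) (u : ℝ → ℂ) : ℝ → ℂ := fun s => u (L * Real.cot s)

/-- `sin s * u_ss s + 2 * cos s * u_s s`, where `u` is taken in the mapped variable. -/
noncomputable def density (L : ℝ) (u : ℝ → ℂ) : ℝ → ℂ := fun s =>
  Real.sin s • deriv (deriv (mapped L u)) s + (2 * Real.cos s) • deriv (mapped L u) s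

/-- A function given on `(0, π)` belongs to `C²[0, π]`: it is the restriction of a function
that is twice continuously differentiable on `[0, π]`, one-sidedly at the end points. -/
def IsC2Closed (g : ℝ → ℂ) : Prop :=
  ∃ f : ℝ → ℂ, ContDiffOn ℝ 2 f (Set.Icc 0 Real.pi) ∧ Set.EqOn g f (Set.Ioo 0 Real.pi)

/-- The factor `c_α |sin s|^(α-1) / (L^α α (1-α))` in front of the integral. -/
noncomputable def prefactor (α L s : ℝ) : ℝ :=
  cConst α * |Real.sin s| ^ (α - 1) / (L ^ α * α * (1 - α))

/-- The integrand of the mapped fractional Laplacian. -/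
noncomputable def integrand (α L : ℝ) (u : ℝ → ℂ) (s η : ℝ) : ℂ :=
  (Real.sin η ^ α / |Real.sin (s - η)| ^ (α - 1)) • density L u η

/-- The fractional Laplacian of `u` (with `α ≠ 1`) at `x = L cot s`, in the mapped form. -/
noncomputable def fracLaplacian (α L : ℝ) (u : ℝ → ℂ) (s : ℝ) : ℂ :=
  prefactor α L s • ∫ η in (0 : ℝ)..Real.pi, integrand α L u s η

/-- The step `h_r = π / (2 r N)`. -/
noncomputable def step (N r : ℕ) : ℝ := Real.pi / (2 * (r : ℝ) * (N : ℝ))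

/-- The fine nodes, `h_r * t`; the index `t` is an integer `n` or a half-integer `n + 1/2`. -/
noncomputable def fineNode (N r : ℕ) (t : ℝ) : ℝ := step N r * t

/-- The evaluation nodes `s_j = (2 j + 1) π / (2 N)`. -/
noncomputable def node (N j : ℕ) : ℝ := (2 * (j : ℝ) + 1) * Real.pi / (2 * (N : ℝ))

/-- `(sgn (b-y) |b-y|^(2-α) - sgn (a-y) |a-y|^(2-α)) / (2-α)`. -/
noncomputable def interiorWeight (α y a b : ℝ) : ℝ :=
  (Real.sign (b - y) * |b - y| ^ (2 - α) - Real.sign (a - y) * |a - y| ^ (2 - α)) / (2 - α)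

/-- The sum `A_{1,j}`, over the subintervals of `[0, π/2]`. -/
noncomputable def A1 (α L : ℝ) (u : ℝ → ℂ) (N r j : ℕ) : ℂ :=
  (1 / step N r * prefactor α L (node N j)) • ∑ n ∈ Finset.range (r * N),
    ((Real.sin (fineNode N r (n + 1 / 2)) / fineNode N r (n + 1 / 2)) ^ α
      * (Real.sin (fineNode N r (n + 1 / 2) - node N j)
          / (fineNode N r (n + 1 / 2) - node N j)) ^ (1 - α)
      * ((fineNode N r (n + 1) ^ (α + 1) - fineNode N r n ^ (α + 1)) / (α + 1))
      * interiorWeight α (node N j) (fineNode N r n) (fineNode N r (n + 1)))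
    • density L u (fineNode N r (n + 1 / 2))

/-- The sum `A_{2,j}`, over the subintervals of `[π/2, π]`. -/
noncomputable def A2 (α L : ℝ) (u : ℝ → ℂ) (N r j : ℕ) : ℂ :=
  (1 / step N r * prefactor α L (node N j)) • ∑ n ∈ Finset.Ico (r * N) (2 * r * N),
    ((Real.sin (fineNode N r (n + 1 / 2)) / (Real.pi - fineNode N r (n + 1 / 2))) ^ α
      * (Real.sin (fineNode N r (n + 1 / 2) - node N j)
          / (fineNode N r (n + 1 / 2) - node N j)) ^ (1 - α)
      * (((Real.pi - fineNode N r n) ^ (α + 1)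
          - (Real.pi - fineNode N r (n + 1)) ^ (α + 1)) / (α + 1))
      * interiorWeight α (node N j) (fineNode N r n) (fineNode N r (n + 1)))
    • density L u (fineNode N r (n + 1 / 2))

end FracLap

/-! The integrand factors as `p * q * F`. Here `p = edgeKernel` is the power `α` of the distance to
the nearer end point, `q = poleKernel` is `|x - s|^(1-α)`, and `F = regularPart` collects `f` and
powers of `sinc`. On a cell of length `h` with midpoint `m`, the scheme replaces `∫ p q F` by `(1/h)
(∫ p) (∫ q) F(m)`, with both kernel integrals exact. Keep one kernel as a weight `w` and absorb the
other into a `C²` function `g`. Taylor expansion of `g` at `m` then leaves the first moment `(∫ w (x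
- m)) g'(m)` plus terms of size `h² ∫ w`, which sum to `O(h²)`. The question is how the first
moments add up.

Away from `s`, take `w = p`, `g = q F`. The moment is at most `h²` times the variation of `p` on the
cell, and `p` is monotone on each half of `[0, π]`, so the variations telescope
(`exists_far_bound`).

Near `s`, take `w = q`, `g = p F`. For `α > 1` a single moment can be of order `h^(3-α)`, too large
for absolute estimates. But `s` is a grid node and `q` is even about it, so on a window symmetric
about `s` the moments multiplied by the fixed vector `g'(s)` cancel. What remains carries `g'(m) -
g'(s) = O(|m - s|)`. That factor turns `q` into the monotone function `Q(x) = (x - s) q(x)`, whose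
increments telescope (`exists_near_bound`).

The window must be a whole number of cells, with a radius bounded above and below independently of
`r`. -/

namespace FracLap

open Set MeasureTheory intervalIntegral

/-! ### Midpoint Taylor expansion against a nonnegative weight. -/

section Taylor

variable {E : Type*} [NormedAddCommGroup E] [NormedSpace ℝ E]

/-- `g'` is a bounded Lipschitz derivative of `g` on `S`, with a quadratic Taylor remainder; all
three bounds hold with the same constant `C`. -/
structure HasC11On (g g' : ℝ → E) (C : ℝ) (S : Set ℝ) : Prop where
  bound : ∀ x ∈ S, ‖g' x‖ ≤ C
  lipschitz : ∀ x ∈ S, ∀ y ∈ S, ‖g' y - g' x‖ ≤ C * |y - x|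
  taylor : ∀ x ∈ S, ∀ y ∈ S, ‖g y - g x - (y - x) • g' x‖ ≤ C * (y - x) ^ 2

theorem HasC11On.mono {g g' : ℝ → E} {C : ℝ} {S T : Set ℝ} (h : HasC11On g g' C S) (hT : T ⊆ S) :
    HasC11On g g' C T :=
  ⟨fun x hx => h.bound x (hT hx), fun x hx y hy => h.lipschitz x (hT hx) y (hT hy),
    fun x hx y hy => h.taylor x (hT hx) y (hT hy)⟩

/-- The second derivative is bounded by compactness, so `g'` is Lipschitz. The mean value inequality
for `z ↦ g z - z • g' x` then gives the quadratic remainder. The case `B ≤ A` is included because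
intervals clipped at `s ± δ` may be empty. -/
theorem exists_hasC11On {g : ℝ → E} {A B : ℝ} (hg : ContDiffOn ℝ 2 g (Icc A B)) :
    ∃ (g' : ℝ → E) (C : ℝ), 0 ≤ C ∧ HasC11On g g' C (Icc A B) := by
  rcases le_or_gt B A with hAB | hAB
  · refine ⟨0, 0, le_rfl, by simp, by simp, fun x hx y hy => ?_⟩
    have : y = x := by linarith [hx.1, hx.2, hy.1, hy.2]
    simp [this]
  have hU := uniqueDiffOn_Icc hAB
  have h1 : ContDiffOn ℝ 1 (derivWithin g (Icc A B)) (Icc A B) :=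
    hg.derivWithin hU (by norm_num)
  have h2 := h1.continuousOn_derivWithin hU le_rfl
  obtain ⟨C₁, hC₁⟩ := isCompact_Icc.exists_bound_of_continuousOn h1.continuousOn
  obtain ⟨C₂, hC₂⟩ := isCompact_Icc.exists_bound_of_continuousOn h2
  have hlip : ∀ x ∈ Icc A B, ∀ y ∈ Icc A B,
      ‖derivWithin g (Icc A B) y - derivWithin g (Icc A B) x‖ ≤ max C₁ C₂ * |y - x| :=
    fun x hx y hy => (convex_Icc A B).norm_image_sub_le_of_norm_derivWithin_le
      (h1.differentiableOn one_ne_zero) (fun z hz => (hC₂ z hz).trans (le_max_right _ _)) hx hy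
  have hC : 0 ≤ max C₁ C₂ :=
    (norm_nonneg _).trans ((hC₁ A (left_mem_Icc.2 hAB.le)).trans (le_max_left _ _))
  refine ⟨derivWithin g (Icc A B), max C₁ C₂, hC,
    fun x hx => (hC₁ x hx).trans (le_max_left _ _), hlip, fun x hx y hy => ?_⟩
  have hsub : uIcc x y ⊆ Icc A B := uIcc_subset_Icc hx hy
  have hd : ∀ z ∈ uIcc x y, HasDerivWithinAt (fun z => g z - z • derivWithin g (Icc A B) x)
      (derivWithin g (Icc A B) z - (1 : ℝ) • derivWithin g (Icc A B) x) (uIcc x y) z := fun z hz =>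
    (((hg.differentiableOn two_ne_zero z (hsub hz)).hasDerivWithinAt).mono hsub).sub
      ((hasDerivWithinAt_id z _).smul_const _)
  have := (convex_uIcc x y).norm_image_sub_le_of_norm_hasDerivWithin_le hd
    (C := max C₁ C₂ * |y - x|) (fun z hz => ?_) left_mem_uIcc right_mem_uIcc
  · calc _ = ‖g y - y • derivWithin g (Icc A B) x - (g x - x • derivWithin g (Icc A B) x)‖ := by
          rw [sub_smul]; congr 1; abel
      _ ≤ _ := this
      _ = _ := by rw [Real.norm_eq_abs, mul_assoc, abs_mul_abs_self, sq]
  · rw [one_smul]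
    refine (hlip x hx z (hsub hz)).trans (mul_le_mul_of_nonneg_left ?_ hC)
    exact abs_sub_left_of_mem_uIcc hz

/-- The Taylor remainder at the midpoint, integrated against `w`. The first moment is kept explicit,
since it is estimated differently near `s` and away from it. -/
theorem norm_integral_smul_sub_le [CompleteSpace E] {w : ℝ → ℝ} {g g' : ℝ → E} {C a b : ℝ}
    (hab : a ≤ b) (hw : IntervalIntegrable w volume a b) (hw0 : ∀ x ∈ Icc a b, 0 ≤ w x)
    (hgc : ContinuousOn g (Icc a b)) (hC : 0 ≤ C) (hg : HasC11On g g' C (Icc a b)) :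
    ‖(∫ x in a..b, w x • g x) - (∫ x in a..b, w x) • g ((a + b) / 2)
        - (∫ x in a..b, w x * (x - (a + b) / 2)) • g' ((a + b) / 2)‖
      ≤ C * (b - a) ^ 2 * ∫ x in a..b, w x := by
  set m := (a + b) / 2 with hm
  have hmm : m ∈ Icc a b := ⟨by linarith, by linarith⟩
  have i1 : IntervalIntegrable (fun x => w x • g x) volume a b :=
    hw.smul_continuousOn (by rwa [uIcc_of_le hab])
  have i2 : IntervalIntegrable (fun x => w x • g m) volume a b :=
    hw.smul_continuousOn continuousOn_const
  have i3' : IntervalIntegrable (fun x => w x * (x - m)) volume a b :=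
    hw.mul_continuousOn (by fun_prop)
  have i3 : IntervalIntegrable (fun x => (w x * (x - m)) • g' m) volume a b :=
    i3'.smul_continuousOn continuousOn_const
  rw [← intervalIntegral.integral_smul_const, ← intervalIntegral.integral_smul_const,
    ← intervalIntegral.integral_sub i1 i2, ← intervalIntegral.integral_sub (i1.sub i2) i3,
    ← intervalIntegral.integral_const_mul]
  refine intervalIntegral.norm_integral_le_of_norm_le hab (ae_of_all _ fun x hx => ?_)
    (hw.const_mul _)
  have hx' : x ∈ Icc a b := Ioc_subset_Icc_self hx
  have e : w x • g x - w x • g m - (w x * (x - m)) • g' m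
      = w x • (g x - g m - (x - m) • g' m) := by
    rw [smul_sub, smul_sub, mul_smul]
  rw [e, norm_smul, Real.norm_of_nonneg (hw0 x hx'), mul_comm]
  refine mul_le_mul_of_nonneg_right ((hg.taylor m hmm x hx').trans ?_) (hw0 x hx')
  refine mul_le_mul_of_nonneg_left ?_ hC
  refine sq_le_sq.2 ?_
  rw [abs_le, abs_of_nonneg (by linarith : (0:ℝ) ≤ b - a)]
  constructor <;> linarith [hx'.1, hx'.2]

theorem integral_sub_midpoint (a b : ℝ) : ∫ x in a..b, (x - (a + b) / 2) = 0 := by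
  rw [intervalIntegral.integral_sub (by simp) (by simp)]
  simp
  ring

theorem abs_integral_sub_midpoint_le {v v' : ℝ → ℝ} {C a b : ℝ} (hab : a ≤ b)
    (hvc : ContinuousOn v (Icc a b)) (hC : 0 ≤ C) (hv : HasC11On v v' C (Icc a b)) :
    |(∫ x in a..b, v x) - (b - a) * v ((a + b) / 2)| ≤ C * (b - a) ^ 3 := by
  -- The constant weight has zero first moment about the midpoint.
  have := norm_integral_smul_sub_le (w := fun _ => 1) hab (by simp) (by simp) hvc hC hv
  simp only [one_mul, integral_sub_midpoint, sub_zero,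
    intervalIntegral.integral_const, smul_eq_mul, mul_one, zero_mul, Real.norm_eq_abs] at this
  refine this.trans (le_of_eq (by ring))

/-- The error, on one cell, of replacing the integral of `w v F` by the product of the mean of `v`,
the integral of `w` and the midpoint value of `F`. -/
theorem norm_cell_error_sub_le [CompleteSpace E] {w v : ℝ → ℝ} {F g' : ℝ → E} {C D M a b : ℝ}
    (hab : a < b)
    (hw : IntervalIntegrable w volume a b) (hw0 : ∀ x ∈ Icc a b, 0 ≤ w x)
    (hgc : ContinuousOn (fun x => v x • F x) (Icc a b)) (hC : 0 ≤ C)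
    (hg : HasC11On (fun x => v x • F x) g' C (Icc a b))
    (hv : |(∫ x in a..b, v x) - (b - a) * v ((a + b) / 2)| ≤ D * (b - a) ^ 3)
    (hM : ‖F ((a + b) / 2)‖ ≤ M) :
    ‖(∫ x in a..b, (w x * v x) • F x)
        - ((1 / (b - a)) * ((∫ x in a..b, w x) * ∫ x in a..b, v x)) • F ((a + b) / 2)
        - (∫ x in a..b, w x * (x - (a + b) / 2)) • g' ((a + b) / 2)‖
      ≤ (C + D * M) * (b - a) ^ 2 * ∫ x in a..b, w x := by
  have h1 := norm_integral_smul_sub_le hab.le hw hw0 hgc hC hg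
  have hba : 0 < b - a := sub_pos.2 hab
  have hW : 0 ≤ ∫ x in a..b, w x := intervalIntegral.integral_nonneg hab.le hw0
  have hD : 0 ≤ D * (b - a) ^ 3 := (abs_nonneg _).trans hv
  -- Exchanging `(b - a) v(m)` for `∫ v` costs order `(b - a)^3`; the factor `1 / (b - a)` leaves a
  -- square.
  have h2 : ‖((1 / (b - a)) * ((∫ x in a..b, w x) *
      ((∫ x in a..b, v x) - (b - a) * v ((a + b) / 2)))) • F ((a + b) / 2)‖
      ≤ D * M * (b - a) ^ 2 * ∫ x in a..b, w x := by
    rw [norm_smul, Real.norm_eq_abs, abs_mul, abs_mul, abs_of_nonneg hW,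
      abs_of_pos (by positivity : 0 < 1 / (b - a))]
    calc _ ≤ 1 / (b - a) * ((∫ x in a..b, w x) * (D * (b - a) ^ 3)) * M := by gcongr
      _ = _ := by field_simp
  calc _ = ‖((∫ x in a..b, w x • (v x • F x)) - (∫ x in a..b, w x) •
          (v ((a + b) / 2) • F ((a + b) / 2))
        - (∫ x in a..b, w x * (x - (a + b) / 2)) • g' ((a + b) / 2)) -
        ((1 / (b - a)) * ((∫ x in a..b, w x) *
          ((∫ x in a..b, v x) - (b - a) * v ((a + b) / 2)))) • F ((a + b) / 2)‖ := by
        congr 1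
        have : (1 / (b - a)) * ((∫ x in a..b, w x) *
          ((∫ x in a..b, v x) - (b - a) * v ((a + b) / 2))) =
          (1 / (b - a)) * ((∫ x in a..b, w x) * ∫ x in a..b, v x)
            - (∫ x in a..b, w x) * v ((a + b) / 2) := by
          field_simp
        rw [this, sub_smul _ _ (F _)]
        simp only [mul_smul]
        abel
    _ ≤ _ := (norm_sub_le _ _).trans (add_le_add h1 h2)
    _ = _ := by ring

end Taylor

/-! ### First moments about cell midpoints: bounds and cancellation. -/

theorem abs_integral_mul_sub_midpoint_le {w : ℝ → ℝ} {a b V : ℝ} (hab : a ≤ b)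
    (hw : IntervalIntegrable w volume a b) (hV : ∀ x ∈ Icc a b, |w x - w a| ≤ V) :
    |∫ x in a..b, w x * (x - (a + b) / 2)| ≤ (b - a) ^ 2 * V := by
  have e : ∫ x in a..b, w x * (x - (a + b) / 2)
      = ∫ x in a..b, (w x - w a) * (x - (a + b) / 2) := by
    simp only [sub_mul (_ : ℝ) (w a)]
    rw [intervalIntegral.integral_sub (hw.mul_continuousOn (by fun_prop))
      (Continuous.intervalIntegrable (by fun_prop) _ _), intervalIntegral.integral_const_mul,
      integral_sub_midpoint, mul_zero, sub_zero]
  rw [e, ← Real.norm_eq_abs]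
  refine (intervalIntegral.norm_integral_le_of_norm_le_const (C := V * (b - a))
    fun x hx => ?_).trans (le_of_eq ?_)
  · rw [uIoc_of_le hab] at hx
    have hx' : x ∈ Icc a b := Ioc_subset_Icc_self hx
    rw [norm_mul, Real.norm_eq_abs, Real.norm_eq_abs]
    have := hV x hx'
    refine mul_le_mul this ?_ (abs_nonneg _) ((abs_nonneg _).trans this)
    rw [abs_le]
    constructor <;> linarith [hx'.1, hx'.2]
  · rw [abs_of_nonneg (by linarith)]; ring

/-- The first moment of a weight `q` about the midpoint of a cell, multiplied by the distance of
the midpoint from `s`. -/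
theorem abs_sub_mul_abs_integral_le {q : ℝ → ℝ} {s a b : ℝ} (hab : a ≤ b)
    (hq : IntervalIntegrable q volume a b) (hq0 : ∀ x ∈ Icc a b, 0 ≤ q x)
    (hQ : MonotoneOn (fun x => (x - s) * q x) (Icc a b)) :
    |(a + b) / 2 - s| * |∫ x in a..b, q x * (x - (a + b) / 2)|
      ≤ (b - a) ^ 2 * (((b - s) * q b - (a - s) * q a) + ∫ x in a..b, q x) := by
  set m := (a + b) / 2 with hm
  have hQi : IntervalIntegrable (fun x => (x - s) * q x) volume a b :=
    hq.continuousOn_mul (by fun_prop)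
  have h1 : |∫ x in a..b, ((x - s) * q x) * (x - m)|
      ≤ (b - a) ^ 2 * ((b - s) * q b - (a - s) * q a) := by
    refine abs_integral_mul_sub_midpoint_le hab hQi fun x hx => ?_
    have h1 := hQ (left_mem_Icc.2 hab) hx hx.1
    have h2 := hQ hx (right_mem_Icc.2 hab) hx.2
    simp only at h1 h2
    rw [abs_of_nonneg (by linarith)]
    linarith
  have h2 : |∫ x in a..b, q x * (x - m) ^ 2| ≤ (b - a) ^ 2 * ∫ x in a..b, q x := by
    rw [← Real.norm_eq_abs, ← intervalIntegral.integral_const_mul]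
    refine intervalIntegral.norm_integral_le_of_norm_le hab (ae_of_all _ fun x hx => ?_)
      (hq.const_mul _)
    have hx' : x ∈ Icc a b := Ioc_subset_Icc_self hx
    rw [Real.norm_of_nonneg (mul_nonneg (hq0 x hx') (sq_nonneg _)), mul_comm]
    refine mul_le_mul_of_nonneg_right ?_ (hq0 x hx')
    refine sq_le_sq.2 ?_
    rw [abs_le, abs_of_nonneg (by linarith : (0:ℝ) ≤ b - a)]
    constructor <;> linarith [hx'.1, hx'.2]
  rw [← abs_mul, ← intervalIntegral.integral_const_mul]
  -- Writing `m - s = (x - s) - (x - m)` trades the possibly unbounded `q` for the monotone `(x - s)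
  -- q`, at the cost of a second moment.
  have e : ∫ x in a..b, (m - s) * (q x * (x - m))
      = (∫ x in a..b, ((x - s) * q x) * (x - m)) - ∫ x in a..b, q x * (x - m) ^ 2 := by
    rw [← intervalIntegral.integral_sub (hQi.mul_continuousOn (by fun_prop))
      (hq.mul_continuousOn (by fun_prop))]
    congr 1
    ext x
    ring
  rw [e, mul_add]
  exact (abs_sub _ _).trans (add_le_add h1 h2)

/-- First moments of a weight that is symmetric about `s` cancel on a symmetric family of cells. -/
theorem sum_integral_mul_sub_midpoint_eq_zero {q : ℝ → ℝ} {s : ℝ} (hq : ∀ x, q (2 * s - x) = q x)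
    (h : ℝ) (M : ℕ) :
    ∑ i ∈ Finset.range (2 * M), ∫ x in (s + (i - M) * h)..(s + (i + 1 - M) * h),
      q x * (x - ((s + (i - M) * h) + (s + (i + 1 - M) * h)) / 2) = 0 := by
  set K : ℕ → ℝ := fun i => ∫ x in (s + (i - M) * h)..(s + (i + 1 - M) * h),
      q x * (x - ((s + (i - M) * h) + (s + (i + 1 - M) * h)) / 2) with hK
  -- The reflection `x ↦ 2 s - x` exchanges cells `i` and `2 M - 1 - i` and changes the sign of the
  -- distance to the midpoint.
  have hneg : ∀ i ∈ Finset.range (2 * M), K (2 * M - 1 - i) = - K i := by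
    intro i hi
    have hi' : i + 1 ≤ 2 * M := Finset.mem_range.1 hi
    have hc : ((2 * M - 1 - i : ℕ) : ℝ) = 2 * M - 1 - i := by
      rw [Nat.sub_sub, Nat.cast_sub (by omega)]; push_cast; ring
    simp only [hK]
    rw [hc, ← intervalIntegral.integral_neg]
    have := intervalIntegral.integral_comp_sub_left (a := s + (i - M) * h)
      (b := s + (i + 1 - M) * h) (fun x => q x * (x - ((s + (2 * M - 1 - i - M) * h) +
        (s + (2 * M - 1 - i + 1 - M) * h)) / 2)) (2 * s)
    rw [show 2 * s - (s + (i + 1 - M) * h) = s + (2 * M - 1 - i - M) * h by ring,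
      show 2 * s - (s + (i - M) * h) = s + (2 * M - 1 - i + 1 - M) * h by ring] at this
    rw [← this]
    congr 1
    ext x
    rw [hq]
    ring
  have h1 := Finset.sum_range_reflect K (2 * M)
  rw [Finset.sum_congr rfl hneg, Finset.sum_neg_distrib] at h1
  linarith

/-! ### Smoothness and positivity of `sinc`. -/

theorem contDiff_sinc {n : WithTop ℕ∞} : ContDiff ℝ n Real.sinc := by
  rw [contDiff_iff_contDiffAt]
  intro x
  rcases eq_or_ne x 0 with rfl | hx
  · rw [Real.sinc_eq_dslope]
    obtain ⟨p, hp⟩ := Real.analyticAt_sin (x := 0)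
    exact (show AnalyticAt ℝ (dslope Real.sin 0) 0 from
      ⟨_, hp.has_fpower_series_dslope_fslope⟩).contDiffAt
  · refine (Real.contDiff_sin.contDiffAt.div contDiffAt_id hx).congr_of_eventuallyEq ?_
    filter_upwards [isOpen_ne.mem_nhds hx] with y hy
    exact Real.sinc_of_ne_zero hy

theorem mul_sinc (x : ℝ) : x * Real.sinc x = Real.sin x := by
  rcases eq_or_ne x 0 with rfl | hx
  · simp
  · rw [Real.sinc_of_ne_zero hx, mul_div_cancel₀ _ hx]

theorem sinc_pos {x : ℝ} (hx : |x| < Real.pi) : 0 < Real.sinc x := by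
  have key : ∀ y : ℝ, 0 ≤ y → y < Real.pi → 0 < Real.sinc y := by
    intro y hy hy'
    rcases hy.eq_or_lt with rfl | h
    · simp
    · rw [Real.sinc_of_ne_zero h.ne']
      exact div_pos (Real.sin_pos_of_pos_of_lt_pi h hy') h
  rcases le_total 0 x with h | h
  · exact key x h ((le_abs_self x).trans_lt hx)
  · rw [← Real.sinc_neg]
    exact key (-x) (by linarith) ((neg_le_abs x).trans_lt hx)

/-! ### Factorisation of the integrand. -/

/-- The distance of a point of `[0, π]` to the nearer end point. -/
noncomputable def edgeDist (x : ℝ) : ℝ := min x (Real.pi - x)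

/-- The factor of the integrand that is singular at the end points. -/
noncomputable def edgeKernel (α x : ℝ) : ℝ := edgeDist x ^ α

/-- The factor of the integrand that is singular at `s`. -/
noncomputable def poleKernel (α s x : ℝ) : ℝ := |x - s| ^ (1 - α)

/-- The remaining, regular factor of the integrand. -/
noncomputable def regularPart (α s : ℝ) (f : ℝ → ℂ) (x : ℝ) : ℂ :=
  (Real.sinc (edgeDist x) ^ α * Real.sinc (x - s) ^ (1 - α)) • f x

theorem edgeDist_of_le {x : ℝ} (hx : x ≤ Real.pi / 2) : edgeDist x = x :=
  min_eq_left (by linarith)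

theorem edgeDist_of_ge {x : ℝ} (hx : Real.pi / 2 ≤ x) : edgeDist x = Real.pi - x :=
  min_eq_right (by linarith)

theorem edgeDist_nonneg {x : ℝ} (hx : x ∈ Icc 0 Real.pi) : 0 ≤ edgeDist x :=
  le_min hx.1 (by linarith [hx.2])

theorem abs_edgeDist_lt {x : ℝ} (hx : x ∈ Icc 0 Real.pi) : |edgeDist x| < Real.pi := by
  rw [abs_of_nonneg (edgeDist_nonneg hx)]
  rcases le_total x (Real.pi / 2) with h | h
  · rw [edgeDist_of_le h]; linarith [Real.pi_pos]
  · rw [edgeDist_of_ge h]; linarith [Real.pi_pos]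

theorem continuous_edgeDist : Continuous edgeDist := by
  unfold edgeDist; fun_prop

theorem sin_edgeDist (x : ℝ) : Real.sin (edgeDist x) = Real.sin x := by
  rcases le_total x (Real.pi / 2) with h | h
  · rw [edgeDist_of_le h]
  · rw [edgeDist_of_ge h, Real.sin_pi_sub]

theorem abs_sub_lt_pi {s x : ℝ} (hs : s ∈ Ioo 0 Real.pi) (hx : x ∈ Icc 0 Real.pi) :
    |x - s| < Real.pi := by
  rw [abs_lt]; constructor <;> linarith [hs.1, hs.2, hx.1, hx.2]

theorem edgeKernel_nonneg {α x : ℝ} (hx : x ∈ Icc 0 Real.pi) : 0 ≤ edgeKernel α x :=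
  Real.rpow_nonneg (edgeDist_nonneg hx) _

theorem poleKernel_nonneg (α s x : ℝ) : 0 ≤ poleKernel α s x :=
  Real.rpow_nonneg (abs_nonneg _) _

theorem poleKernel_reflect (α s x : ℝ) : poleKernel α s (2 * s - x) = poleKernel α s x := by
  unfold poleKernel
  rw [show 2 * s - x - s = -(x - s) by ring, abs_neg]

theorem continuous_edgeKernel {α : ℝ} (hα : 0 ≤ α) : Continuous (edgeKernel α) :=
  continuous_edgeDist.rpow_const fun _ => Or.inr hα

/-- Since `d * sinc d = sin d` and `sin (π - x) = sin x`, the kink of `edgeDist` at `π / 2`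
disappears from the product. -/
theorem edgeKernel_smul_regularPart {α s x : ℝ} (f : ℝ → ℂ) (hx : x ∈ Icc 0 Real.pi) :
    edgeKernel α x • regularPart α s f x
      = (Real.sin x ^ α * Real.sinc (x - s) ^ (1 - α)) • f x := by
  unfold edgeKernel regularPart
  rw [smul_smul, ← mul_assoc, ← Real.mul_rpow (edgeDist_nonneg hx)
    (sinc_pos (abs_edgeDist_lt hx)).le, mul_sinc, sin_edgeDist]

theorem integrand_eq {α L s x : ℝ} {u f : ℝ → ℂ} (hs : s ∈ Ioo 0 Real.pi)
    (hf : EqOn (density L u) f (Ioo 0 Real.pi)) (hx : x ∈ Ioo 0 Real.pi) :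
    integrand α L u s x = (edgeKernel α x * poleKernel α s x) • regularPart α s f x := by
  have hx' := Ioo_subset_Icc_self hx
  have hsx := sinc_pos (abs_sub_lt_pi hs hx')
  rw [mul_comm, mul_smul, edgeKernel_smul_regularPart f hx', smul_smul, integrand, hf hx]
  congr 1
  rw [← neg_sub x s, Real.sin_neg, abs_neg, div_eq_mul_inv,
    ← Real.rpow_neg (abs_nonneg _), neg_sub, poleKernel,
    ← mul_sinc (x - s), abs_mul, abs_of_pos hsx, Real.mul_rpow (abs_nonneg _) hsx.le]
  ring

theorem continuousOn_regularPart {α s : ℝ} {f : ℝ → ℂ} (hs : s ∈ Ioo 0 Real.pi)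
    (hf : ContinuousOn f (Icc 0 Real.pi)) : ContinuousOn (regularPart α s f) (Icc 0 Real.pi) := by
  unfold regularPart
  refine ContinuousOn.smul (M := ℝ) (ContinuousOn.mul (M := ℝ) ?_ ?_) hf
  · exact (Real.continuous_sinc.comp continuous_edgeDist).continuousOn.rpow_const fun x hx =>
      Or.inl (sinc_pos (abs_edgeDist_lt hx)).ne'
  · exact (Real.continuous_sinc.comp (continuous_id.sub continuous_const)).continuousOn.rpow_const
      fun _ hx => Or.inl (sinc_pos (abs_sub_lt_pi hs hx)).ne'

theorem contDiffOn_sinc_sub_rpow {s : ℝ} (hs : s ∈ Ioo 0 Real.pi) (β : ℝ) :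
    ContDiffOn ℝ 2 (fun x => Real.sinc (x - s) ^ β) (Icc 0 Real.pi) :=
  ContDiffOn.rpow_const_of_ne
    (contDiff_sinc.comp (contDiff_id.sub contDiff_const)).contDiffOn
    fun _ hx => (sinc_pos (abs_sub_lt_pi hs hx)).ne'

theorem contDiffOn_poleKernel {α s : ℝ} {S : Set ℝ} (hS : s ∉ S) :
    ContDiffOn ℝ 2 (poleKernel α s) S := by
  have h : ∀ x ∈ S, x - s ≠ 0 := fun x hx h => hS (by rwa [← sub_eq_zero.1 h])
  exact ((contDiff_id.sub contDiff_const).contDiffOn.abs h).rpow_const_of_ne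
    fun x hx => abs_ne_zero.2 (h x hx)

/-- Smoothness holds across `π / 2`, although neither factor need be smooth there. This matters
because the window around `s` may contain `π / 2`, and `s` may equal it. -/
theorem contDiffOn_edgeKernel_smul_regularPart {α s A B : ℝ} {f : ℝ → ℂ} (hs : s ∈ Ioo 0 Real.pi)
    (hf : ContDiffOn ℝ 2 f (Icc 0 Real.pi)) (hA : 0 < A) (hB : B < Real.pi) :
    ContDiffOn ℝ 2 (fun x => edgeKernel α x • regularPart α s f x) (Icc A B) := by
  have hsub : Icc A B ⊆ Icc 0 Real.pi := Icc_subset_Icc hA.le hB.le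
  refine ContDiffOn.congr (f := fun x => (Real.sin x ^ α * Real.sinc (x - s) ^ (1 - α)) • f x) ?_
    fun x hx => edgeKernel_smul_regularPart f (hsub hx)
  refine (ContDiffOn.mul ?_ ((contDiffOn_sinc_sub_rpow hs _).mono hsub)).smul (hf.mono hsub)
  exact Real.contDiff_sin.contDiffOn.rpow_const_of_ne fun x hx =>
    (Real.sin_pos_of_pos_of_lt_pi (hA.trans_le hx.1) (hx.2.trans_lt hB)).ne'

/-! ### The edge kernel on each half of the interval. -/

/-- A subinterval of `[0, π]` that lies in one of its halves. -/
def InHalf (a b : ℝ) : Prop := (0 ≤ a ∧ b ≤ Real.pi / 2) ∨ (Real.pi / 2 ≤ a ∧ b ≤ Real.pi)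

theorem InHalf.subset {a b : ℝ} (h : InHalf a b) : Icc a b ⊆ Icc 0 Real.pi := by
  have := Real.pi_pos
  rcases h with h | h <;> exact Icc_subset_Icc (by linarith) (by linarith)

theorem InHalf.mono {a b A B : ℝ} (h : InHalf A B) (ha : A ≤ a) (hb : b ≤ B) : InHalf a b :=
  h.imp (fun h => ⟨h.1.trans ha, hb.trans h.2⟩) (fun h => ⟨h.1.trans ha, hb.trans h.2⟩)

theorem InHalf.eqOn_edgeDist {a b : ℝ} (h : InHalf a b) :
    EqOn edgeDist id (Icc a b) ∨ EqOn edgeDist (fun x => Real.pi - x) (Icc a b) :=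
  h.imp (fun h _ hx => edgeDist_of_le (hx.2.trans h.2))
    (fun h _ hx => edgeDist_of_ge (h.1.trans hx.1))

theorem InHalf.contDiffOn_edgeDist {a b : ℝ} (h : InHalf a b) :
    ContDiffOn ℝ 2 edgeDist (Icc a b) := by
  rcases h.eqOn_edgeDist with h | h
  · exact contDiffOn_id.congr h
  · exact (contDiff_const.sub contDiff_id).contDiffOn.congr h

theorem InHalf.contDiffOn_edgeKernel {a b α : ℝ} (h : InHalf a b) (ha : 0 < a)
    (hb : b < Real.pi) : ContDiffOn ℝ 2 (edgeKernel α) (Icc a b) :=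
  h.contDiffOn_edgeDist.rpow_const_of_ne fun _ hx =>
    (lt_min (ha.trans_le hx.1) (by linarith [hx.2])).ne'

theorem InHalf.contDiffOn_regularPart {a b α s : ℝ} {f : ℝ → ℂ} (h : InHalf a b)
    (hs : s ∈ Ioo 0 Real.pi) (hf : ContDiffOn ℝ 2 f (Icc 0 Real.pi)) :
    ContDiffOn ℝ 2 (regularPart α s f) (Icc a b) := by
  unfold regularPart
  refine (ContDiffOn.mul ?_ ((contDiffOn_sinc_sub_rpow hs _).mono h.subset)).smul
    (hf.mono h.subset)
  exact (contDiff_sinc.comp_contDiffOn h.contDiffOn_edgeDist).rpow_const_of_ne fun x hx =>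
    (sinc_pos (abs_edgeDist_lt (h.subset hx))).ne'

/-- The variation of `edgeKernel` over a cell in one half of `[0, π]`. -/
theorem InHalf.abs_edgeKernel_sub_le {a b α x : ℝ} (h : InHalf a b) (hα : 0 ≤ α)
    (hx : x ∈ Icc a b) :
    |edgeKernel α x - edgeKernel α a| ≤ |edgeKernel α b - edgeKernel α a| := by
  have hab : a ≤ b := hx.1.trans hx.2
  have ha0 := edgeDist_nonneg (h.subset (left_mem_Icc.2 hab))
  have hx0 := edgeDist_nonneg (h.subset hx)
  have hb0 := edgeDist_nonneg (h.subset (right_mem_Icc.2 hab))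
  unfold edgeKernel
  rcases h.eqOn_edgeDist with e | e
  · rw [e hx, e (left_mem_Icc.2 hab), e (right_mem_Icc.2 hab)] at *
    simp only [id] at *
    have h1 := Real.rpow_le_rpow ha0 hx.1 hα
    have h2 := Real.rpow_le_rpow hx0 hx.2 hα
    rw [abs_of_nonneg (by linarith), abs_of_nonneg (by linarith)]
    linarith
  · rw [e hx, e (left_mem_Icc.2 hab), e (right_mem_Icc.2 hab)] at *
    simp only at *
    have h1 := Real.rpow_le_rpow hx0 (by linarith [hx.1] : Real.pi - x ≤ Real.pi - a) hα
    have h2 := Real.rpow_le_rpow hb0 (by linarith [hx.2] : Real.pi - b ≤ Real.pi - x) hα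
    rw [abs_of_nonpos (by linarith), abs_of_nonpos (by linarith)]
    linarith

theorem edgeKernel_le {α x : ℝ} (hα : 0 ≤ α) (hx : x ∈ Icc 0 Real.pi) :
    edgeKernel α x ≤ Real.pi ^ α :=
  Real.rpow_le_rpow (edgeDist_nonneg hx) ((le_abs_self _).trans (abs_edgeDist_lt hx).le) hα

theorem integral_edgeKernel_left {α a b : ℝ} (hα : 0 < α) (hab : a ≤ b) (hb : b ≤ Real.pi / 2) :
    ∫ x in a..b, edgeKernel α x = (b ^ (α + 1) - a ^ (α + 1)) / (α + 1) := by
  rw [← integral_rpow (Or.inl (by linarith))]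
  refine intervalIntegral.integral_congr fun x hx => ?_
  rw [uIcc_of_le hab] at hx
  simp only [edgeKernel, edgeDist_of_le (hx.2.trans hb)]

theorem integral_edgeKernel_right {α a b : ℝ} (hα : 0 < α) (hab : a ≤ b)
    (ha : Real.pi / 2 ≤ a) :
    ∫ x in a..b, edgeKernel α x
      = ((Real.pi - a) ^ (α + 1) - (Real.pi - b) ^ (α + 1)) / (α + 1) := by
  rw [← integral_rpow (Or.inl (by linarith)),
    ← intervalIntegral.integral_comp_sub_left (fun x => x ^ α)]
  refine intervalIntegral.integral_congr fun x hx => ?_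
  rw [uIcc_of_le hab] at hx
  simp only [edgeKernel, edgeDist_of_ge (ha.trans hx.1)]

/-! ### Integrals of the pole kernel. -/

theorem integrable_and_integral_abs_rpow {r : ℝ} (hr : -1 < r) (c : ℝ) :
    IntervalIntegrable (fun x : ℝ => |x| ^ r) volume 0 c ∧
      ∫ x in (0 : ℝ)..c, |x| ^ r = Real.sign c * |c| ^ (r + 1) / (r + 1) := by
  have key : ∀ d : ℝ, 0 ≤ d → IntervalIntegrable (fun x : ℝ => |x| ^ r) volume 0 d ∧
      ∫ x in (0 : ℝ)..d, |x| ^ r = d ^ (r + 1) / (r + 1) := by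
    intro d hd
    have e : EqOn (fun x : ℝ => x ^ r) (fun x : ℝ => |x| ^ r) (uIcc 0 d) := by
      intro x hx
      rw [uIcc_of_le hd] at hx
      simp only [abs_of_nonneg hx.1]
    refine ⟨(intervalIntegral.intervalIntegrable_rpow' hr).congr
      (e.mono uIoc_subset_uIcc), ?_⟩
    rw [← intervalIntegral.integral_congr e, integral_rpow (Or.inl hr),
      Real.zero_rpow (by linarith), sub_zero]
  rcases lt_trichotomy c 0 with h | rfl | h
  · obtain ⟨h1, h2⟩ := key (-c) (by linarith)
    constructor
    · simpa using h1.comp_sub_left 0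
    · have := intervalIntegral.integral_comp_neg (a := 0) (b := c) (fun x : ℝ => |x| ^ r)
      simp only [abs_neg, neg_zero] at this
      rw [this, intervalIntegral.integral_symm, h2, Real.sign_of_neg h, abs_of_neg h]
      ring
  · simp
  · rw [Real.sign_of_pos h, abs_of_pos h, one_mul]
    exact key c h.le

theorem intervalIntegrable_poleKernel {α : ℝ} (hα : α < 2) (s a b : ℝ) :
    IntervalIntegrable (poleKernel α s) volume a b := by
  have h := fun c => (integrable_and_integral_abs_rpow (r := 1 - α) (by linarith) c).1
  have := ((h (a - s)).symm.trans (h (b - s))).comp_sub_right s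
  simpa only [sub_add_cancel, poleKernel] using! this

theorem integral_poleKernel {α : ℝ} (hα : α < 2) (s a b : ℝ) :
    ∫ x in a..b, poleKernel α s x = interiorWeight α s a b := by
  have h := fun c => integrable_and_integral_abs_rpow (r := 1 - α) (by linarith) c
  unfold poleKernel interiorWeight
  rw [intervalIntegral.integral_comp_sub_right (fun x => |x| ^ (1 - α)),
    ← intervalIntegral.integral_interval_sub_left (h (b - s)).1 (h (a - s)).1, (h _).2, (h _).2,
    show 1 - α + 1 = 2 - α by ring]
  ring

theorem mul_poleKernel_eq (α s x : ℝ) :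
    (x - s) * poleKernel α s x = Real.sign (x - s) * |x - s| ^ (2 - α) := by
  unfold poleKernel
  rcases eq_or_ne (x - s) 0 with h | h
  · simp [h]
  · rw [show 2 - α = 1 + (1 - α) by ring, Real.rpow_add (abs_pos.2 h), Real.rpow_one, ← mul_assoc]
    congr 1
    rcases lt_or_gt_of_ne h with h | h
    · rw [Real.sign_of_neg h, abs_of_neg h]; ring
    · rw [Real.sign_of_pos h, abs_of_pos h]; ring

theorem integral_poleKernel' {α : ℝ} (hα : α < 2) (s a b : ℝ) :
    ∫ x in a..b, poleKernel α s x
      = ((b - s) * poleKernel α s b - (a - s) * poleKernel α s a) / (2 - α) := by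
  rw [integral_poleKernel hα, interiorWeight, mul_poleKernel_eq, mul_poleKernel_eq]

/-- Its increments are `2 - α` times integrals of the nonnegative pole kernel. -/
theorem monotone_mul_poleKernel {α : ℝ} (hα : α < 2) (s : ℝ) :
    Monotone fun x => (x - s) * poleKernel α s x := by
  intro a b hab
  have h : 0 ≤ ∫ x in a..b, poleKernel α s x :=
    intervalIntegral.integral_nonneg hab fun x _ => poleKernel_nonneg α s x
  rw [integral_poleKernel' hα, le_div_iff₀ (by linarith)] at h
  simp only
  linarith

/-! ### Error on a single cell, away from `s` and near it. -/

/-- The quadrature error on the cell `[a, b]`. -/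
noncomputable def cellError (α s : ℝ) (f : ℝ → ℂ) (a b : ℝ) : ℂ :=
  (∫ x in a..b, (edgeKernel α x * poleKernel α s x) • regularPart α s f x)
    - ((1 / (b - a)) * ((∫ x in a..b, edgeKernel α x) * ∫ x in a..b, poleKernel α s x))
      • regularPart α s f ((a + b) / 2)

theorem midpoint_mem_Icc {a b : ℝ} (hab : a ≤ b) : (a + b) / 2 ∈ Icc a b :=
  ⟨by linarith, by linarith⟩

theorem exists_regularPart_bound {α s : ℝ} {f : ℝ → ℂ} (hs : s ∈ Ioo 0 Real.pi)
    (hf : ContinuousOn f (Icc 0 Real.pi)) :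
    ∃ M, 0 ≤ M ∧ ∀ x ∈ Icc 0 Real.pi, ‖regularPart α s f x‖ ≤ M := by
  obtain ⟨M, hM⟩ := isCompact_Icc.exists_bound_of_continuousOn
    (continuousOn_regularPart (α := α) hs hf)
  exact ⟨M, (norm_nonneg _).trans (hM 0 (left_mem_Icc.2 Real.pi_pos.le)), hM⟩

theorem exists_far_cell_bound {α s A B : ℝ} {f : ℝ → ℂ} (hα : 0 < α)
    (hs : s ∈ Ioo 0 Real.pi) (hf : ContDiffOn ℝ 2 f (Icc 0 Real.pi)) (hAB : InHalf A B)
    (hsAB : s ∉ Icc A B) :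
    ∃ C, 0 ≤ C ∧ ∀ a b, A ≤ a → a < b → b ≤ B → ‖cellError α s f a b‖
      ≤ C * ((b - a) ^ 2 * ((b - a) + |edgeKernel α b - edgeKernel α a|)) := by
  have hq : ContDiffOn ℝ 2 (poleKernel α s) (Icc A B) := contDiffOn_poleKernel hsAB
  have hg : ContDiffOn ℝ 2 (fun x => poleKernel α s x • regularPart α s f x) (Icc A B) :=
    hq.smul (hAB.contDiffOn_regularPart hs hf)
  obtain ⟨q', D, hD, hq'⟩ := exists_hasC11On hq
  obtain ⟨g', C, hC, hg'⟩ := exists_hasC11On hg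
  obtain ⟨M, hM0, hM⟩ := exists_regularPart_bound (α := α) hs hf.continuousOn
  refine ⟨(C + D * M) * Real.pi ^ α + C, by positivity, fun a b ha hab hb => ?_⟩
  have hsub : Icc a b ⊆ Icc A B := Icc_subset_Icc ha hb
  have hhalf := hAB.mono ha hb
  have hm := midpoint_mem_Icc hab.le
  have hp := (continuous_edgeKernel hα.le).intervalIntegrable (μ := volume) a b
  have h1 := norm_cell_error_sub_le (F := regularPart α s f) (M := M) hab hp
    (fun x hx => edgeKernel_nonneg (hhalf.subset hx)) (hg.continuousOn.mono hsub) hC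
    (hg'.mono hsub) (abs_integral_sub_midpoint_le hab.le (hq.continuousOn.mono hsub) hD
      (hq'.mono hsub)) (hM _ (hhalf.subset hm))
  have h2 := abs_integral_mul_sub_midpoint_le hab.le hp
    (fun x hx => hhalf.abs_edgeKernel_sub_le hα.le hx)
  have h3 : ‖(∫ x in a..b, edgeKernel α x * (x - (a + b) / 2)) • g' ((a + b) / 2)‖
      ≤ (b - a) ^ 2 * |edgeKernel α b - edgeKernel α a| * C := by
    rw [norm_smul, Real.norm_eq_abs]
    exact mul_le_mul h2 (hg'.bound _ (hsub hm)) (norm_nonneg _) (by positivity)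
  have h4 : ∫ x in a..b, edgeKernel α x ≤ Real.pi ^ α * (b - a) := by
    calc _ ≤ ∫ x in a..b, Real.pi ^ α :=
          intervalIntegral.integral_mono_on hab.le hp (by simp)
            fun x hx => edgeKernel_le hα.le (hhalf.subset hx)
      _ = _ := by simp [mul_comm]
  have h5 := norm_le_norm_sub_add (cellError α s f a b)
    ((∫ x in a..b, edgeKernel α x * (x - (a + b) / 2)) • g' ((a + b) / 2))
  have hba : 0 < b - a := sub_pos.2 hab
  set V := |edgeKernel α b - edgeKernel α a| with hV
  have hV0 : 0 ≤ V := abs_nonneg _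
  calc _ ≤ _ := h5
    _ ≤ (C + D * M) * (b - a) ^ 2 * (Real.pi ^ α * (b - a)) + (b - a) ^ 2 * V * C := by
        refine add_le_add (h1.trans ?_) h3
        gcongr
    -- Nonnegative cross terms are added so that the sum factors with a single constant.
    _ ≤ (C + D * M) * (b - a) ^ 2 * (Real.pi ^ α * (b - a)) + (b - a) ^ 2 * V * C
        + ((C + D * M) * Real.pi ^ α * ((b - a) ^ 2 * V) + C * ((b - a) ^ 2 * (b - a))) :=
        le_add_of_nonneg_right (by positivity)
    _ = _ := by ring

/-- Four fixed intervals, some possibly empty, cover the cases: either half of `[0, π]`, on either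
side of `s`. -/
theorem exists_far_bound {α s δ : ℝ} {f : ℝ → ℂ} (hα : 0 < α)
    (hs : s ∈ Ioo 0 Real.pi) (hf : ContDiffOn ℝ 2 f (Icc 0 Real.pi)) (hδ : 0 < δ) :
    ∃ C, 0 ≤ C ∧ ∀ a b, a < b → InHalf a b → (b ≤ s - δ ∨ s + δ ≤ a) → ‖cellError α s f a b‖
      ≤ C * ((b - a) ^ 2 * ((b - a) + |edgeKernel α b - edgeKernel α a|)) := by
  have hpi := Real.pi_pos
  obtain ⟨C₁, h₁, H₁⟩ := exists_far_cell_bound (A := 0) (B := min (Real.pi / 2) (s - δ)) hα hs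
    hf (Or.inl ⟨le_rfl, min_le_left _ _⟩) fun h => by linarith [h.2.trans (min_le_right _ _)]
  obtain ⟨C₂, h₂, H₂⟩ := exists_far_cell_bound (A := max 0 (s + δ)) (B := Real.pi / 2) hα hs
    hf (Or.inl ⟨le_max_left _ _, le_rfl⟩) fun h => by linarith [(le_max_right _ _).trans h.1]
  obtain ⟨C₃, h₃, H₃⟩ := exists_far_cell_bound (A := Real.pi / 2) (B := min Real.pi (s - δ)) hα
    hs hf (Or.inr ⟨le_rfl, min_le_left _ _⟩) fun h => by linarith [h.2.trans (min_le_right _ _)]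
  obtain ⟨C₄, h₄, H₄⟩ := exists_far_cell_bound (A := max (Real.pi / 2) (s + δ)) (B := Real.pi) hα
    hs hf (Or.inr ⟨le_max_left _ _, le_rfl⟩)
    fun h => by linarith [(le_max_right _ _).trans h.1]
  refine ⟨C₁ + C₂ + C₃ + C₄, by positivity, fun a b hab hh hf => ?_⟩
  have hX : 0 ≤ (b - a) ^ 2 * ((b - a) + |edgeKernel α b - edgeKernel α a|) := by
    have : 0 < b - a := sub_pos.2 hab
    positivity
  rcases hh with hh | hh <;> rcases hf with hf | hf
  · exact (H₁ a b hh.1 hab (le_min hh.2 hf)).trans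
      (mul_le_mul_of_nonneg_right (by linarith) hX)
  · exact (H₂ a b (max_le hh.1 hf) hab hh.2).trans
      (mul_le_mul_of_nonneg_right (by linarith) hX)
  · exact (H₃ a b hh.1 hab (le_min hh.2 hf)).trans
      (mul_le_mul_of_nonneg_right (by linarith) hX)
  · exact (H₄ a b (max_le hh.1 hf) hab hh.2).trans
      (mul_le_mul_of_nonneg_right (by linarith) hX)

theorem exists_edgeKernel_midpoint_bound {α A B : ℝ} (hA : 0 < A) (hB : B < Real.pi) :
    ∃ D, 0 ≤ D ∧ ∀ a b, A ≤ a → a < b → b ≤ B → InHalf a b →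
      |(∫ x in a..b, edgeKernel α x) - (b - a) * edgeKernel α ((a + b) / 2)|
        ≤ D * (b - a) ^ 3 := by
  have i₁ : InHalf A (min (Real.pi / 2) B) := Or.inl ⟨hA.le, min_le_left _ _⟩
  have i₂ : InHalf (max (Real.pi / 2) A) B := Or.inr ⟨le_max_left _ _, hB.le⟩
  have c₁ := i₁.contDiffOn_edgeKernel (α := α) hA ((min_le_right _ _).trans_lt hB)
  have c₂ := i₂.contDiffOn_edgeKernel (α := α) (hA.trans_le (le_max_right _ _)) hB
  obtain ⟨p₁, D₁, h₁, H₁⟩ := exists_hasC11On c₁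
  obtain ⟨p₂, D₂, h₂, H₂⟩ := exists_hasC11On c₂
  refine ⟨D₁ + D₂, by positivity, fun a b ha hab hb hh => ?_⟩
  have hX : 0 ≤ (b - a) ^ 3 := pow_nonneg (sub_nonneg.2 hab.le) 3
  rcases hh with hh | hh
  · have hsub : Icc a b ⊆ Icc A (min (Real.pi / 2) B) := Icc_subset_Icc ha (le_min hh.2 hb)
    exact (abs_integral_sub_midpoint_le hab.le (c₁.continuousOn.mono hsub) h₁
      (H₁.mono hsub)).trans (mul_le_mul_of_nonneg_right (by linarith) hX)
  · have hsub : Icc a b ⊆ Icc (max (Real.pi / 2) A) B := Icc_subset_Icc (max_le hh.1 ha) hb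
    exact (abs_integral_sub_midpoint_le hab.le (c₂.continuousOn.mono hsub) h₂
      (H₂.mono hsub)).trans (mul_le_mul_of_nonneg_right (by linarith) hX)

/-- The vector `c` is the derivative at `s` of the edge kernel times the regular part. It does not
depend on the cell, so the subtracted moments can cancel later. The Lipschitz bound for that
derivative supplies the factor `|m - s|` that tames the remaining moment, and the right-hand side
telescopes. -/
theorem exists_near_bound {α s A B : ℝ} {f : ℝ → ℂ} (hα2 : α < 2)
    (hf : ContDiffOn ℝ 2 f (Icc 0 Real.pi)) (hA : 0 < A) (hB : B < Real.pi)
    (hsAB : s ∈ Icc A B) :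
    ∃ (c : ℂ) (C : ℝ), 0 ≤ C ∧ ∀ a b, A ≤ a → a < b → b ≤ B → InHalf a b →
      ‖cellError α s f a b - (∫ x in a..b, poleKernel α s x * (x - (a + b) / 2)) • c‖
        ≤ C * ((b - a) ^ 2 * ((b - s) * poleKernel α s b - (a - s) * poleKernel α s a)) := by
  have hs : s ∈ Ioo 0 Real.pi := ⟨hA.trans_le hsAB.1, hsAB.2.trans_lt hB⟩
  have hG := contDiffOn_edgeKernel_smul_regularPart (α := α) hs hf hA hB
  obtain ⟨G', C, hC, hG'⟩ := exists_hasC11On hG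
  obtain ⟨D, hD, hp⟩ := exists_edgeKernel_midpoint_bound (α := α) hA hB
  obtain ⟨M, hM0, hM⟩ := exists_regularPart_bound (α := α) hs hf.continuousOn
  have h2α : 0 < 2 - α := by linarith
  refine ⟨G' s, (C + D * M) / (2 - α) + C * (1 + 1 / (2 - α)), by positivity,
    fun a b ha hab hb hh => ?_⟩
  have hsub : Icc a b ⊆ Icc A B := Icc_subset_Icc ha hb
  have hm := midpoint_mem_Icc hab.le
  have hq := intervalIntegrable_poleKernel hα2 s a b
  have h1 := norm_cell_error_sub_le (F := regularPart α s f) (M := M) hab hq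
    (fun x _ => poleKernel_nonneg α s x) (hG.continuousOn.mono hsub) hC
    (hG'.mono hsub) (hp a b ha hab hb hh) (hM _ (hh.subset hm))
  have h2 := abs_sub_mul_abs_integral_le hab.le hq (fun x _ => poleKernel_nonneg α s x)
    ((monotone_mul_poleKernel hα2 s).monotoneOn _)
  have h3 : ‖(∫ x in a..b, poleKernel α s x * (x - (a + b) / 2)) • (G' ((a + b) / 2) - G' s)‖
      ≤ C * (|(a + b) / 2 - s| * |∫ x in a..b, poleKernel α s x * (x - (a + b) / 2)|) := by
    rw [norm_smul, Real.norm_eq_abs, mul_comm, ← mul_assoc]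
    exact mul_le_mul_of_nonneg_right (hG'.lipschitz _ hsAB _ (hsub hm)) (abs_nonneg _)
  rw [integral_poleKernel' hα2] at h1 h2
  set Q := (b - s) * poleKernel α s b - (a - s) * poleKernel α s a with hQ
  have e : cellError α s f a b - (∫ x in a..b, poleKernel α s x * (x - (a + b) / 2)) • G' s
      = ((∫ x in a..b, (poleKernel α s x * edgeKernel α x) • regularPart α s f x)
        - ((1 / (b - a)) * ((Q / (2 - α)) * ∫ x in a..b, edgeKernel α x))
          • regularPart α s f ((a + b) / 2)
        - (∫ x in a..b, poleKernel α s x * (x - (a + b) / 2)) • G' ((a + b) / 2))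
        + (∫ x in a..b, poleKernel α s x * (x - (a + b) / 2)) • (G' ((a + b) / 2) - G' s) := by
    unfold cellError
    rw [integral_poleKernel' hα2, ← hQ, smul_sub, mul_comm (Q / (2 - α))]
    simp only [mul_comm (edgeKernel α _) (poleKernel α s _)]
    abel
  rw [e]
  calc _ ≤ (C + D * M) * (b - a) ^ 2 * (Q / (2 - α)) + C * ((b - a) ^ 2 * (Q + Q / (2 - α))) :=
        (norm_add_le _ _).trans (add_le_add h1 (h3.trans (mul_le_mul_of_nonneg_left h2 hC)))
    _ = _ := by ring

/-! ### Summation over the grid. -/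

/-- A bound for the total quadrature error over a grid `x` of `[0, π]` with spacing `h`, for which
`π / 2` is the node `m`, `s` is the node `J`, and the nodes `J ± M` are at a distance between `δ`
and `ε` from `s`. -/
theorem exists_sum_cellError_bound {α s δ ε : ℝ} {f : ℝ → ℂ} (hα : 0 < α) (hα2 : α < 2)
    (hf : ContDiffOn ℝ 2 f (Icc 0 Real.pi)) (hδ : 0 < δ) (hε : δ ≤ ε) (hs0 : 0 < s - ε)
    (hsπ : s + ε < Real.pi) :
    ∃ C, 0 ≤ C ∧ ∀ (h : ℝ) (m J M : ℕ), 0 < h → h * m = Real.pi / 2 → h * J = s →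
      M ≤ J → J + M ≤ 2 * m → δ ≤ h * M → h * M ≤ ε →
      ‖∑ n ∈ Finset.range (2 * m), cellError α s f (h * n) (h * (n + 1))‖ ≤ C * h ^ 2 := by
  have hpi := Real.pi_pos
  have hs : s ∈ Ioo 0 Real.pi := ⟨by linarith, by linarith⟩
  obtain ⟨C₁, hC₁, H₁⟩ := exists_far_bound hα hs hf hδ
  obtain ⟨c, C₂, hC₂, H₂⟩ := exists_near_bound (s := s) hα2 hf hs0 hsπ
    ⟨by linarith, by linarith⟩
  set Q : ℝ → ℝ := fun x => (x - s) * poleKernel α s x with hQ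
  have hQm : Monotone Q := monotone_mul_poleKernel hα2 s
  have hQ0 : 0 ≤ Q Real.pi - Q 0 := sub_nonneg.2 (hQm hpi.le)
  refine ⟨C₁ * (Real.pi + 2 * Real.pi ^ α) + C₂ * (Q Real.pi - Q 0), by positivity, ?_⟩
  intro h m J M hh hm hJ hMJ hJM hδM hMε
  have hhalf : ∀ n < 2 * m, InHalf (h * n) (h * (n + 1)) := by
    intro n hn
    rcases lt_or_ge n m with hnm | hnm
    · refine Or.inl ⟨by positivity, ?_⟩
      rw [← hm]
      exact mul_le_mul_of_nonneg_left (by exact_mod_cast hnm) hh.le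
    · refine Or.inr ⟨?_, ?_⟩
      · rw [← hm]
        exact mul_le_mul_of_nonneg_left (by exact_mod_cast hnm) hh.le
      · have : h * (n + 1) ≤ h * (2 * m) :=
          mul_le_mul_of_nonneg_left (by exact_mod_cast hn) hh.le
        linarith
  have hlt : ∀ n : ℕ, h * n < h * (n + 1) := fun n => by linarith
  have hstep : ∀ n : ℕ, h * (n + 1) - h * n = h := fun n => by ring
  set V : ℕ → ℝ := fun n => |edgeKernel α (h * (n + 1)) - edgeKernel α (h * n)| with hV
  -- the variation of the edge kernel
  have hp0 : 0 ≤ edgeKernel α 0 := edgeKernel_nonneg ⟨le_rfl, hpi.le⟩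
  have hpπ : 0 ≤ edgeKernel α Real.pi := edgeKernel_nonneg ⟨hpi.le, le_rfl⟩
  have hph : edgeKernel α (Real.pi / 2) ≤ Real.pi ^ α :=
    edgeKernel_le hα.le ⟨by linarith, by linarith⟩
  have hVsum : ∑ n ∈ Finset.range (2 * m), V n ≤ 2 * Real.pi ^ α := by
    -- The kernel rises up to node `m`, which is `π / 2`, and falls afterwards, so both halves
    -- telescope.
    rw [Finset.range_eq_Ico, ← Finset.sum_Ico_consecutive _ (Nat.zero_le m) (by omega)]
    have e₁ : ∑ n ∈ Finset.Ico 0 m, V n = edgeKernel α (Real.pi / 2) - edgeKernel α 0 := by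
      have := Finset.sum_Ico_sub (fun n : ℕ => edgeKernel α (h * n)) (Nat.zero_le m)
      rw [hm, Nat.cast_zero, mul_zero] at this
      rw [← this]
      refine Finset.sum_congr rfl fun n hn => ?_
      have hn' : ((n : ℝ) + 1) ≤ m := by exact_mod_cast (Finset.mem_Ico.1 hn).2
      have hle : h * (n + 1) ≤ Real.pi / 2 := hm ▸ mul_le_mul_of_nonneg_left hn' hh.le
      simp only [hV, edgeKernel]
      push_cast
      rw [edgeDist_of_le hle, edgeDist_of_le ((hlt n).le.trans hle)]
      exact abs_of_nonneg (sub_nonneg.2 (Real.rpow_le_rpow (by positivity) (hlt n).le hα.le))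
    have e₂ : ∑ n ∈ Finset.Ico m (2 * m), V n
        = edgeKernel α (Real.pi / 2) - edgeKernel α Real.pi := by
      have := Finset.sum_Ico_sub (fun n : ℕ => edgeKernel α (h * n)) (by omega : m ≤ 2 * m)
      have hπ : h * ((2 * m : ℕ) : ℝ) = Real.pi := by push_cast; linarith
      rw [hm, hπ] at this
      rw [← neg_sub, ← this, ← Finset.sum_neg_distrib]
      refine Finset.sum_congr rfl fun n hn => ?_
      have hn' : (m : ℝ) ≤ n := by exact_mod_cast (Finset.mem_Ico.1 hn).1
      have hle : Real.pi / 2 ≤ h * n := hm ▸ mul_le_mul_of_nonneg_left hn' hh.le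
      have hn2 : ((n : ℝ) + 1) ≤ (2 * m : ℕ) := by exact_mod_cast (Finset.mem_Ico.1 hn).2
      have hle2 : h * (n + 1) ≤ Real.pi := hπ ▸ mul_le_mul_of_nonneg_left hn2 hh.le
      simp only [hV, edgeKernel]
      push_cast
      rw [edgeDist_of_ge hle, edgeDist_of_ge (hle.trans (hlt n).le)]
      exact abs_of_nonpos (sub_nonpos.2 (Real.rpow_le_rpow (by linarith)
        (by linarith [hlt n]) hα.le))
    rw [e₁, e₂]
    linarith
  have hV0 : ∀ n, 0 ≤ V n := fun n => abs_nonneg _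
  have hbound : ∀ n ∈ Finset.range (2 * m), (n < J - M ∨ J + M ≤ n) →
      ‖cellError α s f (h * n) (h * (n + 1))‖ ≤ C₁ * (h ^ 2 * (h + V n)) := by
    intro n hn hfar
    have := H₁ (h * n) (h * (n + 1)) (hlt n) (hhalf n (Finset.mem_range.1 hn)) ?_
    · rwa [hstep] at this
    · rcases hfar with hfar | hfar
      · left
        have : h * (n + 1 + M : ℕ) ≤ h * J :=
          mul_le_mul_of_nonneg_left (by exact_mod_cast (by omega)) hh.le
        push_cast at this
        linarith
      · right
        have : h * (J + M : ℕ) ≤ h * n :=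
          mul_le_mul_of_nonneg_left (by exact_mod_cast hfar) hh.le
        push_cast at this
        linarith
  have hfarsum : ∀ S ⊆ Finset.range (2 * m), (∀ n ∈ S, n < J - M ∨ J + M ≤ n) →
      ‖∑ n ∈ S, cellError α s f (h * n) (h * (n + 1))‖ ≤ ∑ n ∈ S, C₁ * (h ^ 2 * (h + V n)) :=
    fun S hS hfar => norm_sum_le_of_le _ fun n hn => hbound n (hS hn) (hfar n hn)
  have hL := hfarsum (Finset.Ico 0 (J - M))
    (by rw [Finset.range_eq_Ico]; exact Finset.Ico_subset_Ico le_rfl (by omega))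
    (fun n hn => Or.inl (Finset.mem_Ico.1 hn).2)
  have hR := hfarsum (Finset.Ico (J + M) (2 * m))
    (by rw [Finset.range_eq_Ico]; exact Finset.Ico_subset_Ico (by omega) le_rfl)
    (fun n hn => Or.inr (Finset.mem_Ico.1 hn).1)
  -- the cells near `s`
  have hsymm : ∑ n ∈ Finset.Ico (J - M) (J + M), (∫ x in (h * n)..(h * (n + 1)),
      poleKernel α s x * (x - (h * n + h * (n + 1)) / 2)) = 0 := by
    rw [Finset.sum_Ico_eq_sum_range, show J + M - (J - M) = 2 * M by omega,
      ← sum_integral_mul_sub_midpoint_eq_zero (poleKernel_reflect α s) h M]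
    refine Finset.sum_congr rfl fun i _ => ?_
    have e : h * ((J - M + i : ℕ) : ℝ) = s + (i - M) * h := by
      rw [← hJ]; push_cast [Nat.cast_sub hMJ]; ring
    have e' : h * ((J - M + i : ℕ) + 1 : ℝ) = s + (i + 1 - M) * h := by
      rw [mul_add, e]; ring
    rw [e, e']
  have hN : ‖∑ n ∈ Finset.Ico (J - M) (J + M), cellError α s f (h * n) (h * (n + 1))‖
      ≤ C₂ * (h ^ 2 * (Q Real.pi - Q 0)) := by
    -- By `hsymm` the moment terms may be subtracted without changing the sum.
    have e : ∑ n ∈ Finset.Ico (J - M) (J + M), cellError α s f (h * n) (h * (n + 1))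
        = ∑ n ∈ Finset.Ico (J - M) (J + M), (cellError α s f (h * n) (h * (n + 1))
          - (∫ x in (h * n)..(h * (n + 1)),
            poleKernel α s x * (x - (h * n + h * (n + 1)) / 2)) • c) := by
      rw [Finset.sum_sub_distrib, ← Finset.sum_smul, hsymm, zero_smul, sub_zero]
    rw [e]
    refine (norm_sum_le_of_le (f := fun n : ℕ => (cellError α s f (h * n) (h * (n + 1))
          - (∫ x in (h * n)..(h * (n + 1)),
            poleKernel α s x * (x - (h * n + h * (n + 1)) / 2)) • c))
        (n := fun n : ℕ => C₂ * (h ^ 2 * (Q (h * (n + 1)) - Q (h * n)))) _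
        fun n hn => ?_).trans ?_
    · rw [Finset.mem_Ico] at hn
      have h1 : h * J ≤ h * (n + M : ℕ) :=
        mul_le_mul_of_nonneg_left (by exact_mod_cast (by omega)) hh.le
      have h2 : h * (n + 1 : ℕ) ≤ h * (J + M : ℕ) :=
        mul_le_mul_of_nonneg_left (by exact_mod_cast (by omega)) hh.le
      push_cast at h1 h2
      have := H₂ (h * n) (h * (n + 1)) (by linarith) (hlt n) (by linarith)
        (hhalf n (by omega))
      rwa [hstep] at this
    · rw [← Finset.mul_sum, ← Finset.mul_sum]
      have := Finset.sum_Ico_sub (fun n : ℕ => Q (h * n)) (by omega : J - M ≤ J + M)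
      push_cast at this
      rw [this]
      have h1 : h * ((J : ℝ) + M) ≤ Real.pi := by linarith
      have h2 : 0 ≤ h * ((J - M : ℕ) : ℝ) := by positivity
      have h3 := hQm h1
      have h4 := hQm h2
      exact mul_le_mul_of_nonneg_left (mul_le_mul_of_nonneg_left (by linarith) (sq_nonneg h)) hC₂
  have hsplit : ∀ {A : Type} [AddCommMonoid A] (φ : ℕ → A), ∑ n ∈ Finset.range (2 * m), φ n =
      ∑ n ∈ Finset.Ico 0 (J - M), φ n + ∑ n ∈ Finset.Ico (J - M) (J + M), φ n
        + ∑ n ∈ Finset.Ico (J + M) (2 * m), φ n := by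
    intro A _ φ
    rw [Finset.sum_Ico_consecutive _ (by omega) (by omega),
      Finset.sum_Ico_consecutive _ (by omega) (by omega), Finset.range_eq_Ico]
  have htot : ∑ n ∈ Finset.Ico 0 (J - M), C₁ * (h ^ 2 * (h + V n))
      + ∑ n ∈ Finset.Ico (J + M) (2 * m), C₁ * (h ^ 2 * (h + V n))
      ≤ C₁ * (h ^ 2 * (Real.pi + 2 * Real.pi ^ α)) := by
    -- The nonnegative far bounds are extended to all `2 m` cells, where the lengths `h` add up to
    -- `π`.
    have h1 := hsplit (fun n => C₁ * (h ^ 2 * (h + V n)))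
    have h2 : 0 ≤ ∑ n ∈ Finset.Ico (J - M) (J + M), C₁ * (h ^ 2 * (h + V n)) :=
      Finset.sum_nonneg fun n _ => mul_nonneg hC₁ (mul_nonneg (sq_nonneg _)
        (add_nonneg hh.le (hV0 n)))
    have h3 : ∑ n ∈ Finset.range (2 * m), C₁ * (h ^ 2 * (h + V n))
        ≤ C₁ * (h ^ 2 * (Real.pi + 2 * Real.pi ^ α)) := by
      rw [← Finset.mul_sum, ← Finset.mul_sum, Finset.sum_add_distrib, Finset.sum_const,
        Finset.card_range, nsmul_eq_mul]
      refine mul_le_mul_of_nonneg_left (mul_le_mul_of_nonneg_left (add_le_add ?_ hVsum)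
        (sq_nonneg h)) hC₁
      push_cast
      linarith
    linarith
  rw [hsplit]
  calc _ ≤ _ := (norm_add_le _ _).trans (add_le_add_left (norm_add_le _ _) _)
    _ ≤ C₁ * (h ^ 2 * (Real.pi + 2 * Real.pi ^ α)) + C₂ * (h ^ 2 * (Q Real.pi - Q 0)) := by
        linarith
    _ = _ := by ring

/-! ### Identification with the quadrature sums and choice of the window. -/

theorem node_mem_Ioo {N j : ℕ} (hj : j < N) : node N j ∈ Ioo 0 Real.pi := by
  have hpi := Real.pi_pos
  have hN : (0 : ℝ) < N := by exact_mod_cast (Nat.zero_le j).trans_lt hj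
  have hj' : (j : ℝ) + 1 ≤ N := by exact_mod_cast hj
  unfold node
  refine ⟨by positivity, ?_⟩
  rw [div_lt_iff₀ (by positivity)]
  nlinarith

theorem intervalIntegrable_regular_integrand {α s : ℝ} {f : ℝ → ℂ} (hα : 0 < α) (hα2 : α < 2)
    (hs : s ∈ Ioo 0 Real.pi) (hf : ContinuousOn f (Icc 0 Real.pi)) :
    IntervalIntegrable (fun x => (edgeKernel α x * poleKernel α s x) • regularPart α s f x)
      volume 0 Real.pi := by
  refine IntervalIntegrable.smul_continuousOn ?_ ?_
  · exact (intervalIntegrable_poleKernel hα2 s 0 Real.pi).continuousOn_mul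
      (continuous_edgeKernel hα.le).continuousOn
  · rw [uIcc_of_le Real.pi_pos.le]
    exact continuousOn_regularPart hs hf

theorem ae_integrand_eq {α L s : ℝ} {u f : ℝ → ℂ} (hs : s ∈ Ioo 0 Real.pi)
    (hf : EqOn (density L u) f (Ioo 0 Real.pi)) :
    ∀ᵐ x, x ∈ Ioc 0 Real.pi →
      (edgeKernel α x * poleKernel α s x) • regularPart α s f x = integrand α L u s x := by
  filter_upwards [compl_mem_ae_iff.2 (measure_singleton Real.pi)] with x hx hx'
  exact (integrand_eq hs hf ⟨hx'.1, lt_of_le_of_ne hx'.2 hx⟩).symm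

theorem intervalIntegrable_integrand {α L s : ℝ} {u f : ℝ → ℂ} (hα : 0 < α) (hα2 : α < 2)
    (hs : s ∈ Ioo 0 Real.pi) (hfc : ContinuousOn f (Icc 0 Real.pi))
    (hf : EqOn (density L u) f (Ioo 0 Real.pi)) :
    IntervalIntegrable (integrand α L u s) volume 0 Real.pi := by
  refine (intervalIntegrable_regular_integrand hα hα2 hs hfc).congr_ae ?_
  rw [uIoc_of_le Real.pi_pos.le, Filter.EventuallyEq, ae_restrict_iff' measurableSet_Ioc]
  exact ae_integrand_eq hs hf

theorem step_pos {N r : ℕ} (hN : 1 ≤ N) (hr : 1 ≤ r) : 0 < step N r := by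
  have : (0 : ℝ) < N := by exact_mod_cast hN
  have : (0 : ℝ) < r := by exact_mod_cast hr
  unfold step
  positivity

theorem step_mul {N r : ℕ} (hN : 1 ≤ N) (hr : 1 ≤ r) : step N r * (r * N : ℕ) = Real.pi / 2 := by
  have : (0 : ℝ) < N := by exact_mod_cast hN
  have : (0 : ℝ) < r := by exact_mod_cast hr
  unfold step
  push_cast
  field_simp

/-- The fractional Laplacian minus its approximation is the prefactor times the sum of the cell
errors. -/
theorem fracLaplacian_sub_eq {α L s : ℝ} {u f : ℝ → ℂ} {N r j : ℕ} (hα : 0 < α) (hα2 : α < 2)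
    (hj : j < N) (hr : 1 ≤ r) (hs : node N j = s) (hfc : ContinuousOn f (Icc 0 Real.pi))
    (hsJ : ∃ J : ℕ, step N r * J = s) (hf : EqOn (density L u) f (Ioo 0 Real.pi)) :
    fracLaplacian α L u (node N j) - A1 α L u N r j - A2 α L u N r j
      = prefactor α L s • ∑ n ∈ Finset.range (2 * (r * N)),
        cellError α s f (step N r * n) (step N r * (n + 1)) := by
  have hpi := Real.pi_pos
  have hN : 1 ≤ N := (Nat.zero_le j).trans_lt hj
  have hs' : s ∈ Ioo 0 Real.pi := hs ▸ node_mem_Ioo hj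
  have hh := step_pos hN hr
  have hm := step_mul hN hr
  set h := step N r with hdef
  set m := r * N with hmdef
  set Φ : ℝ → ℂ := fun x => (edgeKernel α x * poleKernel α s x) • regularPart α s f x with hΦ
  have hΦi := intervalIntegrable_regular_integrand hα hα2 hs' hfc
  have hint : (∫ x in (0 : ℝ)..Real.pi, integrand α L u s x)
      = ∑ n ∈ Finset.range (2 * m), ∫ x in (h * n)..(h * (n + 1)), Φ x := by
    have h1 : (∫ x in (0 : ℝ)..Real.pi, integrand α L u s x) = ∫ x in (0 : ℝ)..Real.pi, Φ x := by
      refine intervalIntegral.integral_congr_ae ?_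
      rw [uIoc_of_le hpi.le]
      filter_upwards [ae_integrand_eq (α := α) hs' hf] with x hx hx'
      exact (hx hx').symm
    have h2 := intervalIntegral.sum_integral_adjacent_intervals (f := Φ) (μ := volume)
      (a := fun n : ℕ => h * n) (n := 2 * m) fun k hk => hΦi.mono_set ?_
    · push_cast at h2
      rw [h2, h1]
      congr 1
      · ring
      · linarith
    · have hk' : h * (k + 1 : ℕ) ≤ h * (2 * m : ℕ) :=
        mul_le_mul_of_nonneg_left (by exact_mod_cast hk) hh.le
      have hk0 : 0 ≤ h * k := by positivity
      have hkk : h * k ≤ h * (k + 1 : ℕ) := by push_cast; linarith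
      push_cast at hk' hkk ⊢
      rw [uIcc_of_le hkk, uIcc_of_le hpi.le]
      exact Icc_subset_Icc hk0 (by linarith)
  -- the quadrature terms
  have hmid : ∀ n : ℕ, (h * n + h * (n + 1)) / 2 = h * (n + 1 / 2) := fun n => by ring
  have hmidmem : ∀ n < 2 * m, h * ((n : ℝ) + 1 / 2) ∈ Ioo 0 Real.pi := by
    intro n hn
    have hk' : h * (n + 1 : ℕ) ≤ h * (2 * m : ℕ) :=
      mul_le_mul_of_nonneg_left (by exact_mod_cast hn) hh.le
    push_cast at hk'
    exact ⟨by positivity, by linarith⟩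
  -- By parity no midpoint equals the grid node `s`. At such a point the quotient `sin 0 / 0` would
  -- be `0`, while `sinc 0 = 1`.
  have hne : ∀ n : ℕ, h * ((n : ℝ) + 1 / 2) - s ≠ 0 := by
    intro n hn
    obtain ⟨J, hJ⟩ := hsJ
    have : h * ((n : ℝ) + 1 / 2) = h * J := by linarith
    have h3 : (n : ℝ) + 1 / 2 = J := mul_left_cancel₀ hh.ne' this
    have h4 : ((2 * n + 1 : ℕ) : ℝ) = (2 * J : ℕ) := by push_cast; linarith
    have h5 : 2 * n + 1 = 2 * J := by exact_mod_cast h4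
    omega
  set T : ℕ → ℂ := fun n => ((1 / h) * ((∫ x in (h * n)..(h * (n + 1)), edgeKernel α x) *
    ∫ x in (h * n)..(h * (n + 1)), poleKernel α s x)) • regularPart α s f (h * (n + 1 / 2)) with hT
  have hA1 : A1 α L u N r j = prefactor α L s • ∑ n ∈ Finset.Ico 0 m, T n := by
    unfold A1
    rw [hs, ← hdef, mul_comm (1 / h), mul_smul, Finset.smul_sum, Finset.range_eq_Ico]
    congr 1
    refine Finset.sum_congr rfl fun n hn => ?_
    have hn' := (Finset.mem_Ico.1 hn).2
    have hle : h * (n + 1 : ℕ) ≤ h * m :=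
      mul_le_mul_of_nonneg_left (by exact_mod_cast hn') hh.le
    push_cast at hle
    have hx := hmidmem n (by omega)
    simp only [hT, fineNode, ← hdef]
    rw [integral_edgeKernel_left hα (by linarith) (by linarith), integral_poleKernel hα2,
      regularPart, edgeDist_of_le (by linarith), Real.sinc_of_ne_zero hx.1.ne',
      Real.sinc_of_ne_zero (hne n), hf hx, smul_smul, smul_smul]
    congr 1
    ring
  have hA2 : A2 α L u N r j = prefactor α L s • ∑ n ∈ Finset.Ico m (2 * m), T n := by
    unfold A2
    rw [hs, ← hdef, mul_comm (1 / h), mul_smul, Finset.smul_sum, mul_assoc 2 r N]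
    congr 1
    refine Finset.sum_congr rfl fun n hn => ?_
    have hn' := Finset.mem_Ico.1 hn
    have hle : h * m ≤ h * n :=
      mul_le_mul_of_nonneg_left (by exact_mod_cast hn'.1) hh.le
    have hx := hmidmem n (by omega)
    simp only [hT, fineNode, ← hdef]
    rw [integral_edgeKernel_right hα (by linarith) (by linarith), integral_poleKernel hα2,
      regularPart, edgeDist_of_ge (by linarith), Real.sinc_of_ne_zero (by linarith [hx.2]),
      Real.sinc_of_ne_zero (hne n), hf hx, smul_smul, smul_smul, Real.sin_pi_sub]
    congr 1
    ring
  rw [hA1, hA2, sub_sub, ← smul_add, Finset.sum_Ico_consecutive _ (Nat.zero_le m) (by omega),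
    ← Finset.range_eq_Ico, fracLaplacian, hs, hint, ← smul_sub, ← Finset.sum_sub_distrib]
  congr 1
  refine Finset.sum_congr rfl fun n _ => ?_
  simp only [cellError, hT, hmid]
  rw [show h * ((n : ℝ) + 1) - h * n = h by ring]

theorem exists_error_bound_at_node {α L : ℝ} (hα : 0 < α) (hα2 : α < 2) {u f : ℝ → ℂ}
    (hfd : ContDiffOn ℝ 2 f (Icc 0 Real.pi)) (hf : EqOn (density L u) f (Ioo 0 Real.pi))
    {N j : ℕ} (hj : j < N) :
    ∃ K : ℝ, 0 ≤ K ∧ ∀ r : ℕ, 1 ≤ r →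
      ‖fracLaplacian α L u (node N j) - A1 α L u N r j - A2 α L u N r j‖ ≤ K / (r : ℝ) ^ 2 := by
  have hpi := Real.pi_pos
  have hN : 1 ≤ N := (Nat.zero_le j).trans_lt hj
  have hN0 : (0 : ℝ) < N := by exact_mod_cast hN
  set H := Real.pi / (2 * N) with hH
  have hH0 : 0 < H := by positivity
  have hs : node N j = (2 * j + 1) * H := by rw [node, hH]; ring
  have hj' : (j : ℝ) + 1 ≤ N := by exact_mod_cast hj
  have hHN : 2 * N * H = Real.pi := by rw [hH]; field_simp
  have hstep : ∀ r : ℕ, step N r = H / r := by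
    intro r
    rw [step, hH, div_div]
    ring
  have hjH : (j : ℝ) * H + H ≤ N * H := by nlinarith
  have hjH0 : 0 ≤ (j : ℝ) * H := by positivity
  -- The node is at distance at least `H` from both end points. A window of `r / 2` (rounded down)
  -- cells of length `H / r` on each side has radius between `H / 3` and `H / 2` once `r ≥ 2`.
  obtain ⟨C, hC, hbound⟩ := exists_sum_cellError_bound (s := node N j) (δ := H / 3) (ε := H / 2)
    hα hα2 hfd (by positivity) (by linarith) (by rw [hs]; linarith) (by rw [hs]; linarith)
  set err : ℕ → ℝ := fun r =>
    ‖fracLaplacian α L u (node N j) - A1 α L u N r j - A2 α L u N r j‖ with herr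
  -- For `r = 1` the window would be empty, so that single error is put into the constant.
  refine ⟨|prefactor α L (node N j)| * (C * H ^ 2) + err 1, by positivity, fun r hr => ?_⟩
  have hr0 : (0 : ℝ) < r := by exact_mod_cast hr
  rcases hr.eq_or_lt with rfl | hr2
  · simp only [Nat.cast_one, one_pow, div_one]
    exact le_add_of_nonneg_left (by positivity)
  have hJ : step N r * ((r * (2 * j + 1) : ℕ) : ℝ) = node N j := by
    rw [hstep, hs]
    push_cast
    field_simp
  have hM3 : (r : ℝ) ≤ 3 * (r / 2 : ℕ) := by exact_mod_cast (by omega : r ≤ 3 * (r / 2))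
  have hM2 : (2 : ℝ) * (r / 2 : ℕ) ≤ r := by exact_mod_cast (by omega : 2 * (r / 2) ≤ r)
  have hjr : r * (2 * j + 1) + r ≤ 2 * (r * N) := by nlinarith
  have hrj : r ≤ r * (2 * j + 1) := Nat.le_mul_of_pos_right r (by omega)
  have key := hbound (step N r) (r * N) (r * (2 * j + 1)) (r / 2) (step_pos hN hr)
    (step_mul hN hr) hJ (by omega) (by omega)
    (by rw [hstep, div_mul_eq_mul_div, le_div_iff₀ hr0]; nlinarith)
    (by rw [hstep, div_mul_eq_mul_div, div_le_iff₀ hr0]; nlinarith)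
  rw [fracLaplacian_sub_eq hα hα2 hj hr rfl hfd.continuousOn ⟨_, hJ⟩ hf, norm_smul,
    Real.norm_eq_abs, add_div]
  calc _ ≤ |prefactor α L (node N j)| * (C * step N r ^ 2) :=
        mul_le_mul_of_nonneg_left key (abs_nonneg _)
    _ = |prefactor α L (node N j)| * (C * H ^ 2) / (r : ℝ) ^ 2 := by
        rw [hstep, div_pow]; ring
    _ ≤ _ := le_add_of_nonneg_right (by positivity)

end FracLap

theorem mainTheorem3 (α L : ℝ) (hα : α ∈ Set.Ioo (0 : ℝ) 1 ∪ Set.Ioo (1 : ℝ) 2) (hL : 0 < L)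
    (u : ℝ → ℂ)
    (hu1 : DifferentiableOn ℝ (FracLap.mapped L u) (Set.Ioo 0 Real.pi))
    (hu2 : DifferentiableOn ℝ (deriv (FracLap.mapped L u)) (Set.Ioo 0 Real.pi))
    (hu : FracLap.IsC2Closed (FracLap.density L u))
    (N : ℕ) (hN : 1 ≤ N) :
    (∀ j < N, IntervalIntegrable (FracLap.integrand α L u (FracLap.node N j))
      MeasureTheory.volume 0 Real.pi) ∧
    ∃ K : ℝ, 0 < K ∧ ∀ r : ℕ, 1 ≤ r → ∀ j < N,
      ‖FracLap.fracLaplacian α L u (FracLap.node N j)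
          - FracLap.A1 α L u N r j - FracLap.A2 α L u N r j‖ ≤ K / (r : ℝ) ^ 2 := by
  have hα0 : 0 < α := hα.elim (fun h => h.1) (fun h => one_pos.trans h.1)
  have hα2 : α < 2 := hα.elim (fun h => h.2.trans one_lt_two) (fun h => h.2)
  obtain ⟨f, hfd, hf⟩ := hu
  refine ⟨fun j hj => FracLap.intervalIntegrable_integrand hα0 hα2 (FracLap.node_mem_Ioo hj)
    hfd.continuousOn hf, ?_⟩
  have hnode := fun j : Fin N => FracLap.exists_error_bound_at_node hα0 hα2 hfd hf j.2
  choose K hK0 hK using hnode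
  have hsum : 0 ≤ ∑ j, K j := Finset.sum_nonneg fun j _ => hK0 j
  -- Summing over the finitely many nodes makes the constant uniform in `j`; the `1` makes it
  -- strictly positive.
  refine ⟨∑ j, K j + 1, by positivity, fun r hr j hj => (hK ⟨j, hj⟩ r hr).trans ?_⟩
  have : K ⟨j, hj⟩ ≤ ∑ j, K j :=
    Finset.single_le_sum (fun j _ => hK0 j) (Finset.mem_univ (⟨j, hj⟩ : Fin N))
  gcongr
  linarith
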